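/- Let $\mathcal H$ be a complex Hilbert space, and let $X_1,X_2$ be locally compact, second countable Hausdorff spaces with their Borel $\sigma$-algebras $\mathcal B(X_i)$. A POVM on a measurable space $X$ is a normalized map $F$ from the measurable sets of $X$ to the positive bounded operators on $\mathcal H$ ($F(X)=\mathbf 1$) that is countably additive in the weak operator topology; it is a PVM if moreover $F(\Delta)F(\Delta')=\mathbf 0$ for disjoint $\Delta,\Delta'$. Two POVMs $F_1$ on $X_1$ and $F_2$ on $X_2$ are compatible if there is a POVM $F$ on $X_1\times X_2$ (with the product $\sigma$-algebra) such that $F_1(\Delta)=F(\Delta\times X_2)$ and $F_2(\Delta)=F(X_1\times\Delta)$ for all measurable $\Delta$. For a (possibly unbounded) self-adjoint operator $A=\int\lambda\,dE^A_\lambda$ on $\mathcal H$ with spectral measure $E^A$, a POVM $F$ on $X$ is a smearing of $A$ if there is a Markov kernel $\mu:\mathbb R\times\mathcal B(X)\to[0,1]$ with $$F(\Delta)=\mu_\Delta(A)=\int\mu_\Delta(\lambda)\,dE^A_\lambda\qquad\text{for all }\Delta\in\mathcal B(X).$$ For a measurable function $f:\sigma(A)\to\mathbb R$, the operator $f(A)=\int_{\sigma(A)}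 f(\lambda)\,dE^A_\lambda$ has domain $\{\psi:\int f^2\,d\langle E^A\psi,\psi\rangle<\infty\}$; the function $f$ is called almost everywhere bijective (onto its image) if it is one-to-one on a Borel set $N'\subseteq\sigma(A)$ with $E^A(\sigma(A)\setminus N')=\mathbf 0$. **Theorem.** Let $A_1,A_2$ be self-adjoint operators on $\mathcal H$, and let $F_1$ on $X_1$ and $F_2$ on $X_2$ be compatible POVMs such that $F_1$ is a smearing of $A_1$ and $F_2$ is a smearing of $A_2$. Let $f_1:\sigma(A_1)\to\mathbb R$ and $f_2:\sigma(A_2)\to\mathbb R$ be measurable and almost everywhere bijective (with respect to $E^{A_1}$ and $E^{A_2}$ respectively). Then $F_1$ and $F_2$ are compatible smearings of $f_1(A_1)$ and $f_2(A_2)$: they are compatible, $F_1$ is a smearing of $f_1(A_1)$, and $F_2$ is a smearing of $f_2(A_2)$. -/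

import Mathlib

open MeasureTheory ProbabilityTheory Filter Topology
open scoped ENNReal

/-- A normalized positive operator valued measure (POVM) on a measurable space `X`, with values in
the bounded operators on a complex Hilbert space `H`. Countable additivity is in the weak operator
topology. Only the values on measurable sets are meaningful. -/
structure POVM (X H : Type*) [MeasurableSpace X] [NormedAddCommGroup H] [InnerProductSpace ℂ H] where
  toFun : Set X → H →L[ℂ] H
  isPositive' : ∀ s, MeasurableSet s → (toFun s).IsPositive
  hasSum' : ∀ Δ : ℕ → Set X, (∀ n, MeasurableSet (Δ n)) → Pairwise (Function.onFun Disjoint Δ) →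
    ∀ ψ φ : H, HasSum (fun n => inner ℂ ψ (toFun (Δ n) φ)) (inner ℂ ψ (toFun (⋃ n, Δ n) φ))
  univ' : toFun Set.univ = 1

namespace POVM

variable {X H : Type*} [MeasurableSpace X] [NormedAddCommGroup H] [InnerProductSpace ℂ H]

instance : CoeFun (POVM X H) (fun _ => Set X → H →L[ℂ] H) := ⟨POVM.toFun⟩

theorem inner_empty (F : POVM X H) (ψ φ : H) : inner ℂ ψ (F ∅ φ) = 0 := by
  have h := F.hasSum' (fun _ => ∅) (fun _ => MeasurableSet.empty)
    (fun i j _ => by simp [Function.onFun]) ψ φ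
  exact tendsto_nhds_unique tendsto_const_nhds h.summable.tendsto_atTop_zero

theorem empty (F : POVM X H) : F ∅ = 0 := by
  ext φ
  exact ext_inner_left ℂ (fun ψ => by rw [F.inner_empty]; simp)

theorem union (F : POVM X H) {s t : Set X} (hs : MeasurableSet s) (ht : MeasurableSet t)
    (h : Disjoint s t) : F (s ∪ t) = F s + F t := by
  ext φ
  refine ext_inner_left ℂ (fun ψ => ?_)
  have hd : Pairwise (Function.onFun Disjoint
      (fun n : ℕ => if n = 0 then s else if n = 1 then t else ∅)) := by
    intro i j hij
    rcases i with _ | _ | i <;> rcases j with _ | _ | j <;> simp_all [Function.onFun, h.symm]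
  have h1 := F.hasSum' _ (fun n => by split_ifs <;> simp [hs, ht]) hd ψ φ
  have h2 : (⋃ n : ℕ, if n = 0 then s else if n = 1 then t else ∅) = s ∪ t := by
    ext x
    simp only [Set.mem_iUnion, Set.mem_union]
    constructor
    · rintro ⟨n, hn⟩
      split_ifs at hn <;> simp_all
    · rintro (hx | hx)
      · exact ⟨0, by simpa using hx⟩
      · exact ⟨1, by simpa using hx⟩
  rw [h2] at h1
  have h3 := hasSum_sum_of_ne_finset_zero (L := SummationFilter.unconditional ℕ) (s := Finset.range 2)
    (f := fun n : ℕ => inner ℂ ψ (F (if n = 0 then s else if n = 1 then t else ∅) φ))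
    (fun n hn => by
      simp only [Finset.mem_range, not_lt] at hn
      rw [if_neg (by omega), if_neg (by omega), F.inner_empty])
  rw [h1.unique h3]
  simp [Finset.sum_range_succ, inner_add_right]

/-- The measure `Δ ↦ ⟨F(Δ)ψ, ψ⟩`. -/
noncomputable def measure (F : POVM X H) (ψ : H) : Measure X :=
  Measure.ofMeasurable (fun s _ => ENNReal.ofReal (inner ℂ ψ (F s ψ)).re)
    (by simp [F.inner_empty])
    (by
      intro Δ hΔ hd
      have h := Complex.hasSum_re (F.hasSum' Δ hΔ hd ψ ψ)
      rw [← h.tsum_eq, ENNReal.ofReal_tsum_of_nonneg (fun n => ?_) h.summable]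
      exact (F.isPositive' _ (hΔ n)).re_inner_nonneg_right ψ)

theorem measure_apply (F : POVM X H) (ψ : H) {s : Set X} (hs : MeasurableSet s) :
    F.measure ψ s = ENNReal.ofReal (inner ℂ ψ (F s ψ)).re :=
  Measure.ofMeasurable_apply s hs

instance (F : POVM X H) (ψ : H) : IsFiniteMeasure (F.measure ψ) :=
  ⟨by rw [F.measure_apply ψ MeasurableSet.univ]; exact ENNReal.ofReal_lt_top⟩

theorem measure_smul (F : POVM X H) (c : ℂ) (ψ : H) :
    F.measure (c • ψ) = ENNReal.ofReal (‖c‖ ^ 2) • F.measure ψ := by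
  ext s hs
  rw [Measure.smul_apply, measure_apply _ _ hs, measure_apply _ _ hs, smul_eq_mul,
    ← ENNReal.ofReal_mul (by positivity), map_smul, inner_smul_left, inner_smul_right, ← mul_assoc,
    ← Complex.normSq_eq_conj_mul_self, Complex.re_ofReal_mul, Complex.normSq_eq_norm_sq]

theorem measure_add_le (F : POVM X H) (ψ φ : H) :
    F.measure (ψ + φ) ≤ (2 : ℝ≥0∞) • (F.measure ψ + F.measure φ) := by
  refine Measure.le_iff.2 (fun s hs => ?_)
  have hp := F.isPositive' s hs
  have h0 := hp.re_inner_nonneg_right (ψ - φ)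
  have h1 := hp.re_inner_nonneg_right ψ
  have h2 := hp.re_inner_nonneg_right φ
  simp only [RCLike.re_to_complex] at h0 h1 h2
  rw [Measure.smul_apply, Measure.add_apply, measure_apply _ _ hs, measure_apply _ _ hs,
    measure_apply _ _ hs, smul_eq_mul, ← ENNReal.ofReal_add h1 h2,
    show (2 : ℝ≥0∞) = ENNReal.ofReal 2 by simp, ← ENNReal.ofReal_mul (by norm_num)]
  apply ENNReal.ofReal_le_ofReal
  simp only [map_add, map_sub, inner_add_left, inner_add_right, inner_sub_left, inner_sub_right,
    Complex.add_re, Complex.sub_re] at h0 ⊢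
  linarith

/-- `B = ∫ f dF` for a bounded operator `B` and a bounded measurable real function `f`:
`⟨Bψ, ψ⟩ = ∫ f d⟨F ψ, ψ⟩` for every `ψ`. -/
def IsBoundedIntegral (F : POVM X H) (f : X → ℝ) (B : H →L[ℂ] H) : Prop :=
  ∀ ψ : H, inner ℂ ψ (B ψ) = ((∫ x, f x ∂(F.measure ψ) : ℝ) : ℂ)

/-- Compatibility (joint measurability): `F₁` and `F₂` are the marginals of a POVM on the product. -/
def Compatible {X₁ X₂ : Type*} [MeasurableSpace X₁] [MeasurableSpace X₂]
    (F₁ : POVM X₁ H) (F₂ : POVM X₂ H) : Prop :=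
  ∃ F : POVM (X₁ × X₂) H,
    (∀ Δ, MeasurableSet Δ → F₁ Δ = F (Δ ×ˢ Set.univ)) ∧
    (∀ Δ, MeasurableSet Δ → F₂ Δ = F (Set.univ ×ˢ Δ))

/-- A function `f` on `N ⊆ X` is almost everywhere one-to-one with respect to `F` if it is
one-to-one on a measurable `N' ⊆ N` with `F (N \ N') = 0`. -/
def AEOneToOne (F : POVM X H) {N : Set X} (f : N → ℝ) : Prop :=
  ∃ N' : Set X, N' ⊆ N ∧ MeasurableSet N' ∧ F (N \ N') = 0 ∧
    Set.InjOn f (Subtype.val ⁻¹' N')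

end POVM

/-- A projection valued measure (spectral measure): an orthogonal normalized POVM. -/
structure PVM (X H : Type*) [MeasurableSpace X] [NormedAddCommGroup H] [InnerProductSpace ℂ H]
    extends POVM X H where
  orthogonal' : ∀ s t, MeasurableSet s → MeasurableSet t → Disjoint s t → toFun s * toFun t = 0

namespace PVM

variable {X H : Type*} [MeasurableSpace X] [NormedAddCommGroup H] [InnerProductSpace ℂ H]

/-- The integral `∑ y • E(s = y)` of a simple function `s`. -/
noncomputable def simpleIntegral (E : PVM X H) (s : SimpleFunc X ℝ) : H →L[ℂ] H :=
  ∑ y ∈ s.range, (y : ℂ) • E.toPOVM (s ⁻¹' {y})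

theorem apply_mul_self (E : PVM X H) {s : Set X} (hs : MeasurableSet s) :
    E.toPOVM s * E.toPOVM s = E.toPOVM s := by
  have h1 := E.toPOVM.union hs hs.compl disjoint_compl_right
  have hu := E.univ'
  rw [Set.union_compl_self] at h1
  have h2 : E.toPOVM s * E.toPOVM sᶜ = 0 := E.orthogonal' _ _ hs hs.compl disjoint_compl_right
  calc E.toPOVM s * E.toPOVM s = E.toPOVM s * (E.toPOVM s + E.toPOVM sᶜ) := by
        rw [mul_add, h2, add_zero]
    _ = E.toPOVM s := by rw [← h1, hu, mul_one]

theorem inner_apply_apply (E : PVM X H) {s t : Set X} (hs : MeasurableSet s) (ψ φ : H) :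
    inner ℂ (E.toPOVM s ψ) (E.toPOVM t φ) = inner ℂ ψ ((E.toPOVM s * E.toPOVM t) φ) :=
  (E.isPositive' s hs).1 ψ (E.toPOVM t φ)

theorem measure_real_eq (E : PVM X H) (ψ : H) {s : Set X} (hs : MeasurableSet s) :
    (((E.measure ψ).real s : ℝ) : ℂ) = inner ℂ ψ (E.toPOVM s ψ) := by
  have hp := (E.isPositive' s hs)
  have h0 : 0 ≤ (inner ℂ ψ (E.toPOVM s ψ)).re := hp.re_inner_nonneg_right ψ
  rw [Measure.real, E.toPOVM.measure_apply ψ hs, ENNReal.toReal_ofReal h0]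
  have := (Complex.nonneg_iff.1 (hp.inner_nonneg_right ψ)).2
  exact Complex.ext rfl (by simpa using this)

theorem norm_simpleIntegral_sq (E : PVM X H) (s : SimpleFunc X ℝ) (ψ : H) :
    ‖E.simpleIntegral s ψ‖ ^ 2 = ∫ x, s x ^ 2 ∂(E.measure ψ) := by
  have h1 : ∫ x, s x ^ 2 ∂(E.measure ψ) = ∑ y ∈ s.range, (E.measure ψ).real (s ⁻¹' {y}) * y ^ 2 := by
    have := SimpleFunc.map_integral (μ := E.measure ψ) s (fun y : ℝ => y ^ 2)
      ((SimpleFunc.integrable_of_isFiniteMeasure s)) (by simp)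
    rw [SimpleFunc.integral_eq_integral _ (SimpleFunc.integrable_of_isFiniteMeasure _)] at this
    simpa using this
  rw [h1]
  apply Complex.ofReal_injective
  have h2 : ((‖E.simpleIntegral s ψ‖ ^ 2 : ℝ) : ℂ)
      = inner ℂ (E.simpleIntegral s ψ) (E.simpleIntegral s ψ) := by
    rw [inner_self_eq_norm_sq_to_K]; simp
  rw [h2]
  simp only [simpleIntegral, sum_apply, smul_apply,
    sum_inner, inner_sum, inner_smul_left, inner_smul_right, Complex.conj_ofReal]
  push_cast
  refine Finset.sum_congr rfl (fun y hy => ?_)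
  rw [Finset.sum_eq_single y]
  · rw [E.inner_apply_apply (s.measurableSet_preimage _), E.apply_mul_self
      (s.measurableSet_preimage _), ← E.measure_real_eq ψ (s.measurableSet_preimage _)]
    ring
  · intro z _ hz
    rw [E.inner_apply_apply (s.measurableSet_preimage _), show E.toPOVM (s ⁻¹' {z}) *
      E.toPOVM (s ⁻¹' {y}) = 0 from E.orthogonal' _ _ (s.measurableSet_preimage _)
      (s.measurableSet_preimage _) (Disjoint.preimage _ (by simpa using hz))]
    simp
  · exact fun h => absurd hy h

theorem enorm_simpleIntegral (E : PVM X H) (s : SimpleFunc X ℝ) (ψ : H) :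
    ‖E.simpleIntegral s ψ‖ₑ = eLpNorm s 2 (E.measure ψ) := by
  have h2 := (s.memLp_of_isFiniteMeasure 2 (E.measure ψ)).eLpNorm_eq_integral_rpow_norm
    (by norm_num) (by norm_num)
  rw [h2, ← ofReal_norm]
  congr 1
  have h := E.norm_simpleIntegral_sq s ψ
  have h3 : ∫ x, ‖s x‖ ^ (ENNReal.toReal 2) ∂(E.measure ψ) = ∫ x, s x ^ 2 ∂(E.measure ψ) := by
    congr 1; ext x; simp
  rw [h3, ← h, ENNReal.toReal_ofNat, ← one_div, ← Real.sqrt_eq_rpow, Real.sqrt_sq (norm_nonneg _)]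

theorem simpleIntegral_sub (E : PVM X H) (s t : SimpleFunc X ℝ) (ψ : H) :
    E.simpleIntegral (s - t) ψ = E.simpleIntegral s ψ - E.simpleIntegral t ψ := by
  let T : Set X → ℝ →L[ℝ] H := fun u => ContinuousLinearMap.smulRight (1 : ℝ →L[ℝ] ℝ) (E.toPOVM u ψ)
  have hT : FinMeasAdditive (E.measure ψ) T := by
    intro u v hu hv _ _ huv
    ext
    simp [T, E.toPOVM.union hu hv huv]
  have key : ∀ r : SimpleFunc X ℝ, E.simpleIntegral r ψ = SimpleFunc.setToSimpleFunc T r := by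
    intro r
    simp [simpleIntegral, SimpleFunc.setToSimpleFunc, T]
  rw [key, key, key]
  exact SimpleFunc.setToSimpleFunc_sub T hT (SimpleFunc.integrable_of_isFiniteMeasure s)
    (SimpleFunc.integrable_of_isFiniteMeasure t)

/-- The domain `{ψ | ∫ g² d⟨E ψ, ψ⟩ < ∞}` of the operator `∫ g dE`. -/
def integralDomain (E : PVM X H) (g : X → ℝ) : Submodule ℂ H where
  carrier := {ψ | MemLp g 2 (E.measure ψ)}
  zero_mem' := by
    have h : E.measure 0 = 0 := by
      have := E.toPOVM.measure_smul 0 0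
      simpa using this
    simp [h]
  add_mem' := by
    intro ψ φ hψ hφ
    have hψ' : MemLp g 2 (E.measure ψ) := hψ
    have hφ' : MemLp g 2 (E.measure φ) := hφ
    have hm : AEStronglyMeasurable g (E.measure ψ + E.measure φ) :=
      hψ'.1.add_measure hφ'.1
    have h : MemLp g 2 (E.measure ψ + E.measure φ) :=
      (memLp_two_iff_integrable_sq hm).2 (hψ'.integrable_sq.add_measure hφ'.integrable_sq)
    exact h.of_measure_le_smul (by simp) (E.toPOVM.measure_add_le ψ φ)
  smul_mem' := by
    intro c ψ hψ
    change MemLp g 2 (E.measure (c • ψ))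
    rw [E.toPOVM.measure_smul]
    exact MemLp.smul_measure hψ ENNReal.ofReal_ne_top

/-- Simple functions converging pointwise to `g`, and in `L²(μ)` whenever `g ∈ L²(μ)`. -/
noncomputable def approx {g : X → ℝ} (hg : Measurable g) (n : ℕ) : SimpleFunc X ℝ :=
  SimpleFunc.approxOn g hg (Set.range g ∪ {0}) 0 (by simp) n

theorem exists_tendsto [CompleteSpace H] (E : PVM X H) {g : X → ℝ} (hg : Measurable g) {ψ : H}
    (hψ : ψ ∈ E.integralDomain g) :
    ∃ χ : H, Tendsto (fun n => E.simpleIntegral (approx hg n) ψ) atTop (𝓝 χ) := by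
  have hψ' : MemLp g 2 (E.measure ψ) := hψ
  have hlim := SimpleFunc.tendsto_approxOn_range_Lp_eLpNorm (by norm_num) hg hψ'.2
  refine cauchySeq_tendsto_of_complete (EMetric.cauchySeq_iff.2 (fun ε hε => ?_))
  have hε2 : 0 < ε / 2 := ENNReal.half_pos hε.ne'
  obtain ⟨N, hN⟩ := eventually_atTop.1 (hlim.eventually (gt_mem_nhds hε2))
  refine ⟨N, fun m hm n hn => ?_⟩
  rw [edist_eq_enorm_sub, ← E.simpleIntegral_sub, E.enorm_simpleIntegral]
  have hmeas : ∀ k, AEStronglyMeasurable (⇑(approx hg k) - g) (E.measure ψ) := fun k =>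
    ((approx hg k).measurable.sub hg).aestronglyMeasurable
  have e : ⇑(approx hg m - approx hg n) = (⇑(approx hg m) - g) - (⇑(approx hg n) - g) := by
    ext x; simp
  rw [e]
  calc eLpNorm ((⇑(approx hg m) - g) - (⇑(approx hg n) - g)) 2 (E.measure ψ)
      ≤ eLpNorm (⇑(approx hg m) - g) 2 (E.measure ψ)
        + eLpNorm (⇑(approx hg n) - g) 2 (E.measure ψ) :=
        eLpNorm_sub_le (hmeas m) (hmeas n) (by norm_num)
    _ < ε / 2 + ε / 2 := ENNReal.add_lt_add (hN m hm) (hN n hn)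
    _ = ε := ENNReal.add_halves ε

/-- The (in general unbounded) operator `∫ g dE`, for a real measurable `g`: its domain is
`{ψ | ∫ g² d⟨E ψ, ψ⟩ < ∞}`, and its value at `ψ` is the limit of the integrals of simple functions
that converge to `g` in `L²(⟨E ψ, ψ⟩)`. -/
noncomputable def integral [CompleteSpace H] (E : PVM X H) {g : X → ℝ} (hg : Measurable g) :
    H →ₗ.[ℂ] H where
  domain := E.integralDomain g
  toFun := linearMapOfTendsto (fun ψ => (E.exists_tendsto hg ψ.2).choose)
    (fun n => (E.simpleIntegral (approx hg n)).toLinearMap ∘ₗ (E.integralDomain g).subtype)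
    (tendsto_pi_nhds.2 fun ψ => (E.exists_tendsto hg ψ.2).choose_spec)

open Classical in
/-- The PVM concentrated at a point. -/
noncomputable def dirac (H : Type*) [NormedAddCommGroup H] [InnerProductSpace ℂ H] (x : X) :
    PVM X H where
  toFun s := if x ∈ s then 1 else 0
  isPositive' := by
    intro s _
    split_ifs
    · exact ContinuousLinearMap.isPositive_one
    · exact ContinuousLinearMap.isPositive_zero
  hasSum' := by
    intro Δ _ hd ψ φ
    by_cases h : ∃ n, x ∈ Δ n
    · obtain ⟨n, hn⟩ := h
      rw [if_pos (Set.mem_iUnion.2 ⟨n, hn⟩)]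
      have := hasSum_single (f := fun k => inner ℂ ψ ((if x ∈ Δ k then 1 else 0 : H →L[ℂ] H) φ)) n
        (fun k hk => by
          rw [if_neg (fun hx => Set.disjoint_left.1 (hd hk) hx hn)]; simp)
      simpa [hn] using this
    · have h' : ∀ n, x ∉ Δ n := fun n hn => h ⟨n, hn⟩
      simp [h']
  univ' := by simp
  orthogonal' := by
    intro s t _ _ hst
    by_cases hs : x ∈ s
    · simp [Set.disjoint_left.1 hst hs]
    · simp [hs]

end PVM

namespace LinearPMap

variable {H : Type*} [NormedAddCommGroup H] [InnerProductSpace ℂ H]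

/-- The spectrum of a self-adjoint operator `A`, as a set of reals: the `t` for which `A - t` is not
a bijection of the domain of `A` onto `H`. (As `A` is closed, the inverse of such a bijection is
automatically bounded; as `A` is self-adjoint, its spectrum is real.) -/
def realSpectrum (A : H →ₗ.[ℂ] H) : Set ℝ :=
  {t | ¬ Function.Bijective (fun ψ : A.domain => A ψ - (t : ℂ) • (ψ : H))}

theorem isClosed_realSpectrum [CompleteSpace H] {A : H →ₗ.[ℂ] H} (hA : IsSelfAdjoint A) :
    _root_.IsClosed A.realSpectrum := by
  rw [← isOpen_compl_iff, Metric.isOpen_iff]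
  intro t₀ ht₀
  simp only [realSpectrum, Set.mem_compl_iff, Set.mem_ofPred_eq, not_not] at ht₀
  let B : A.domain →ₗ[ℂ] H := A.toFun - (t₀ : ℂ) • A.domain.subtype
  have hB : Function.Bijective B := ht₀
  let e : A.domain ≃ₗ[ℂ] H := LinearEquiv.ofBijective B hB
  let R : H →ₗ[ℂ] H := A.domain.subtype ∘ₗ e.symm.toLinearMap
  have hg : _root_.IsClosed (R.graph : Set (H × H)) := by
    have h1 : (R.graph : Set (H × H)) =
        (fun p : H × H => (p.2, p.1 + (t₀ : ℂ) • p.2)) ⁻¹' (A.graph : Set (H × H)) := by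
      ext ⟨χ, ψ⟩
      simp only [SetLike.mem_coe, LinearMap.mem_graph_iff, Set.mem_preimage, mem_graph_iff]
      constructor
      · intro h
        refine ⟨e.symm χ, h.symm, ?_⟩
        have h2 : e (e.symm χ) = χ := e.apply_symm_apply χ
        have h3 : A (e.symm χ) - (t₀ : ℂ) • ((e.symm χ : A.domain) : H) = χ := h2
        rw [h, ← sub_eq_iff_eq_add]
        exact h3
      · rintro ⟨y, hy, h⟩
        have h3 : e y = χ := by
          change A y - (t₀ : ℂ) • (y : H) = χ
          rw [h, ← hy, add_sub_cancel_right]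
        rw [← h3]
        simp [R, hy]
    rw [h1]
    exact hA.isClosed.preimage (by fun_prop)
  let R' : H →L[ℂ] H := ContinuousLinearMap.ofIsClosedGraph hg
  refine ⟨(‖R'‖ + 1)⁻¹, by positivity, fun t ht => ?_⟩
  simp only [realSpectrum, Set.mem_compl_iff, Set.mem_ofPred_eq, not_not]
  have hn : ‖((t - t₀ : ℝ) : ℂ) • R'‖ < 1 := by
    rw [norm_smul, Complex.norm_real, ← dist_eq_norm]
    have h1 : dist t t₀ < (‖R'‖ + 1)⁻¹ := ht
    calc dist t t₀ * ‖R'‖ ≤ (‖R'‖ + 1)⁻¹ * ‖R'‖ := by gcongr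
      _ < 1 := by
        rw [inv_mul_lt_iff₀ (by positivity)]
        linarith
  let u := Units.oneSub _ hn
  have hu : Function.Bijective (u : H →L[ℂ] H) := by
    refine Function.bijective_iff_has_inverse.2 ⟨(↑u⁻¹ : H →L[ℂ] H), fun x => ?_, fun x => ?_⟩
    · rw [← mul_apply_eq_comp, u.inv_mul]; rfl
    · rw [← mul_apply_eq_comp, u.mul_inv]; rfl
  have key : (fun ψ : A.domain => A ψ - (t : ℂ) • (ψ : H)) = (u : H →L[ℂ] H) ∘ B := by
    ext ψ
    have h1 : R' (B ψ) = ψ := by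
      have : e.symm (e ψ) = ψ := e.symm_apply_apply ψ
      change ((e.symm (e ψ) : A.domain) : H) = ψ
      rw [this]
    have h2 : (u : H →L[ℂ] H) (B ψ) = B ψ - ((t - t₀ : ℝ) : ℂ) • R' (B ψ) := rfl
    rw [Function.comp_apply, h2, h1]
    change _ = A ψ - (t₀ : ℂ) • (ψ : H) - _
    push_cast
    rw [sub_smul]
    abel
  rw [key]
  exact hu.comp hB

/-- `E` is the spectral measure of `A`, i.e. `A = ∫ λ dE_λ`. -/
def IsSpectralMeasure [CompleteSpace H] (A : H →ₗ.[ℂ] H) (E : PVM ℝ H) : Prop :=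
  E.integral measurable_id = A

open Classical in
/-- The spectral measure of a self-adjoint operator `A`. By the spectral theorem it exists, and its
values on Borel sets are unique. (On operators without a spectral measure, the value is a dummy.) -/
noncomputable def spectralMeasure [CompleteSpace H] (A : H →ₗ.[ℂ] H) : PVM ℝ H :=
  if h : ∃ E : PVM ℝ H, A.IsSpectralMeasure E then h.choose else PVM.dirac H 0

theorem measurable_extend [CompleteSpace H] {A : H →ₗ.[ℂ] H} (hA : IsSelfAdjoint A)
    {f : A.realSpectrum → ℝ} (hf : Measurable f) :
    Measurable (Function.extend Subtype.val f 0) :=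
  (MeasurableEmbedding.subtype_coe (isClosed_realSpectrum hA).measurableSet).measurable_extend
    hf measurable_const

/-- The operator `f(A) = ∫ f dE^A` for a self-adjoint `A` and a real measurable function `f` on the
spectrum of `A`. The spectral measure is concentrated on the spectrum, so the extension of `f` by
zero is immaterial. -/
noncomputable def borelFun [CompleteSpace H] (A : H →ₗ.[ℂ] H) (hA : IsSelfAdjoint A)
    (f : A.realSpectrum → ℝ) (hf : Measurable f) : H →ₗ.[ℂ] H :=
  A.spectralMeasure.integral (measurable_extend hA hf)

end LinearPMap

/-- `F` is a smearing of the self-adjoint operator `A`: there is a Markov kernel `κ` such that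
`F(Δ) = ∫ κ_Δ(t) dE_t = κ_Δ(A)` for all measurable `Δ`, where `A = ∫ t dE_t`. -/
def POVM.IsSmearing {X H : Type*} [MeasurableSpace X] [NormedAddCommGroup H]
    [InnerProductSpace ℂ H] [CompleteSpace H] (F : POVM X H) (A : H →ₗ.[ℂ] H) : Prop :=
  ∃ E : PVM ℝ H, A.IsSpectralMeasure E ∧ ∃ κ : Kernel ℝ X, IsMarkovKernel κ ∧
    ∀ Δ, MeasurableSet Δ → E.IsBoundedIntegral (fun t => (κ t).real Δ) (F Δ)

/-!
Compatibility does not mention `A₁` and `A₂`, so the content is that a smearing `F` of a self-adjoint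
operator `A` is a smearing of `f(A)` whenever `f` is almost everywhere one-to-one
(`POVM.IsSmearing.borelFun`). If `F(Δ) = ∫ κ_Δ dE^A`, let `k` be a Borel function with `k (f t) = t`
for `E^A`-almost every `t`; it exists by the Lusin–Souslin theorem. The spectral measure of `f(A)` is
the image `f_* E^A` (`PVM.isSpectralMeasure_map`), so by change of variables
`F(Δ) = ∫ κ_Δ(k(f(t))) dE^A_t = ∫ κ_Δ(k(s)) d(f_* E^A)_s`, and `κ ∘ k` is a kernel that exhibits `F`
as a smearing of `f(A)`.

Two facts of spectral theory enter.

* The spectral measure is unique (`LinearPMap.IsSpectralMeasure.measure_eq`). This identifies the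
  measure given by the smearing with the chosen one that defines `f(A)`. If `E` and `E'` are spectral
  measures of `A`, `I` is the ball of radius `r` about `c`, and the Borel set `S` is at distance at
  least `R > r` from `c`, then `Y = E'(S) E(I)` satisfies `R ‖Y‖ ≤ r ‖Y‖`, because `Y` intertwines
  the restrictions of `A - c` to the two ranges. Hence `Y = 0`; letting `R` tend to `r` shows that
  `E` and `E'` agree on compact intervals.
* The spectral measure is concentrated on the spectrum
  (`LinearPMap.IsSpectralMeasure.measure_compl_realSpectrum`), where alone `f` is given.

Both rest on the isometry `‖(∫ g dE - c) ψ‖ = ‖g - c‖` in `L²(⟨E ψ, ψ⟩)`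
(`PVM.enorm_integral_sub_smul`).
-/

/-! ### Projection valued measures and their integrals -/

namespace PVM

variable {X H : Type*} [MeasurableSpace X] [NormedAddCommGroup H] [InnerProductSpace ℂ H]

theorem apply_mul_apply (E : PVM X H) {s t : Set X} (hs : MeasurableSet s) (ht : MeasurableSet t) :
    E.toPOVM s * E.toPOVM t = E.toPOVM (s ∩ t) := by
  have h1 := E.toPOVM.union (hs.inter ht) (hs.diff ht) Set.disjoint_sdiff_inter.symm
  have h2 := E.toPOVM.union (hs.inter ht) (ht.diff hs)
    (Set.disjoint_sdiff_right.mono_left Set.inter_subset_left)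
  rw [Set.inter_union_sdiff] at h1
  rw [Set.inter_comm s t, Set.inter_union_sdiff, Set.inter_comm t s] at h2
  have h3 : E.toPOVM (s ∩ t) * E.toPOVM (t \ s) = 0 := E.orthogonal' _ _ (hs.inter ht) (ht.diff hs)
    (Set.disjoint_sdiff_right.mono_left Set.inter_subset_left)
  have h4 : E.toPOVM (s \ t) * E.toPOVM (s ∩ t) = 0 := E.orthogonal' _ _ (hs.diff ht) (hs.inter ht)
    Set.disjoint_sdiff_inter
  have h5 : E.toPOVM (s \ t) * E.toPOVM (t \ s) = 0 := E.orthogonal' _ _ (hs.diff ht) (ht.diff hs)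
    (Set.disjoint_sdiff_right.mono_left Set.sdiff_subset)
  rw [h1, h2, add_mul, mul_add, mul_add, h3, h4, h5, E.apply_mul_self (hs.inter ht)]
  simp

theorem apply_apply (E : PVM X H) {s t : Set X} (hs : MeasurableSet s) (ht : MeasurableSet t)
    (ψ : H) : E.toPOVM s (E.toPOVM t ψ) = E.toPOVM (s ∩ t) ψ := by
  rw [← E.apply_mul_apply hs ht]; rfl

theorem apply_compl (E : PVM X H) {s : Set X} (hs : MeasurableSet s) (ψ : H) :
    E.toPOVM sᶜ ψ = ψ - E.toPOVM s ψ := by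
  have h := E.toPOVM.union hs hs.compl disjoint_compl_right
  rw [Set.union_compl_self, E.univ'] at h
  rw [eq_sub_iff_add_eq', ← add_apply, ← h]
  rfl

theorem norm_apply_sq (E : PVM X H) {s : Set X} (hs : MeasurableSet s) (ψ : H) :
    ‖E.toPOVM s ψ‖ ^ 2 = (E.measure ψ).real s := by
  apply Complex.ofReal_injective
  have h := inner_self_eq_norm_sq_to_K (𝕜 := ℂ) (E.toPOVM s ψ)
  rw [E.inner_apply_apply hs, E.apply_mul_self hs] at h
  rw [E.measure_real_eq ψ hs, h]
  simp

theorem apply_eq_zero_iff (E : PVM X H) {s : Set X} (hs : MeasurableSet s) (ψ : H) :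
    E.toPOVM s ψ = 0 ↔ E.measure ψ s = 0 := by
  rw [← norm_eq_zero, ← sq_eq_zero_iff, E.norm_apply_sq hs,
    measureReal_eq_zero_iff]

theorem measure_apply_apply (E : PVM X H) {s : Set X} (hs : MeasurableSet s) (ψ : H) :
    E.measure (E.toPOVM s ψ) = (E.measure ψ).restrict s := by
  ext t ht
  rw [Measure.restrict_apply ht, E.toPOVM.measure_apply _ ht, E.toPOVM.measure_apply _ (ht.inter hs),
    E.apply_apply ht hs, E.inner_apply_apply hs, E.apply_mul_apply hs (ht.inter hs),
    ← Set.inter_assoc, Set.inter_comm s t, Set.inter_assoc, Set.inter_self]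

theorem simpleIntegral_apply (E : PVM X H) (r : SimpleFunc X ℝ) {s : Set X} (hs : MeasurableSet s)
    (ψ : H) : E.simpleIntegral r (E.toPOVM s ψ) = E.toPOVM s (E.simpleIntegral r ψ) := by
  simp only [simpleIntegral, sum_apply, smul_apply, map_sum, map_smul]
  refine Finset.sum_congr rfl fun y _ => ?_
  rw [E.apply_apply (r.measurableSet_preimage _) hs, E.apply_apply hs (r.measurableSet_preimage _),
    Set.inter_comm]

theorem simpleIntegral_const [Nonempty X] (E : PVM X H) (c : ℝ) (ψ : H) :
    E.simpleIntegral (SimpleFunc.const X c) ψ = (c : ℂ) • ψ := by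
  have h : E.toFun (Function.const X c ⁻¹' {c}) = 1 := by
    rw [← E.univ']
    congr 1
    ext
    simp
  simp [simpleIntegral, h]

theorem enorm_eq_eLpNorm_one [Nonempty X] (E : PVM X H) (ψ : H) :
    ‖ψ‖ₑ = eLpNorm (fun _ => (1 : ℝ)) 2 (E.measure ψ) := by
  have h := E.enorm_simpleIntegral (SimpleFunc.const X 1) ψ
  rw [simpleIntegral_const, Complex.ofReal_one, one_smul] at h
  exact h

theorem ae_measure_apply (E : PVM X H) {s : Set X} (hs : MeasurableSet s) (ψ : H) :
    ∀ᵐ x ∂E.measure (E.toPOVM s ψ), x ∈ s := by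
  rw [E.measure_apply_apply hs]
  exact ae_restrict_mem hs

variable [CompleteSpace H]

theorem tendsto_simpleIntegral_approx (E : PVM X H) {g : X → ℝ} (hg : Measurable g)
    (ψ : (E.integral hg).domain) :
    Tendsto (fun n => E.simpleIntegral (approx hg n) ψ) atTop (𝓝 (E.integral hg ψ)) :=
  (E.exists_tendsto hg ψ.2).choose_spec

theorem tendsto_eLpNorm_approx (E : PVM X H) {g : X → ℝ} (hg : Measurable g)
    (ψ : (E.integral hg).domain) :
    Tendsto (fun n => eLpNorm (⇑(approx hg n) - g) 2 (E.measure ψ)) atTop (𝓝 0) :=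
  SimpleFunc.tendsto_approxOn_range_Lp_eLpNorm (by norm_num) hg
    (show MemLp g 2 (E.measure (ψ : H)) from ψ.2).2

/-- `(∫ g dE) ψ` is the limit of the integrals of any simple functions converging to `g` in
`L²(⟨E ψ, ψ⟩)`, not only of the chosen ones. -/
theorem tendsto_simpleIntegral (E : PVM X H) {g : X → ℝ} (hg : Measurable g)
    (ψ : (E.integral hg).domain) {s : ℕ → SimpleFunc X ℝ}
    (hs : Tendsto (fun n => eLpNorm (⇑(s n) - g) 2 (E.measure ψ)) atTop (𝓝 0)) :
    Tendsto (fun n => E.simpleIntegral (s n) ψ) atTop (𝓝 (E.integral hg ψ)) := by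
  suffices h : Tendsto (fun n => E.simpleIntegral (approx hg n) ψ - E.simpleIntegral (s n) ψ) atTop
      (𝓝 0) by
    simpa using (E.tendsto_simpleIntegral_approx hg ψ).sub h
  refine tendsto_zero_iff_enorm_tendsto_zero.2 ?_
  refine tendsto_of_tendsto_of_tendsto_of_le_of_le tendsto_const_nhds
    (by simpa using (E.tendsto_eLpNorm_approx hg ψ).add hs) (fun _ => zero_le) (fun n => ?_)
  have hm : ∀ r : SimpleFunc X ℝ, AEStronglyMeasurable (⇑r - g) (E.measure (ψ : H)) := fun r =>
    (r.measurable.sub hg).aestronglyMeasurable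
  rw [← E.simpleIntegral_sub, E.enorm_simpleIntegral, SimpleFunc.coe_sub,
    ← sub_sub_sub_cancel_right _ _ g]
  exact eLpNorm_sub_le (hm _) (hm _) (by norm_num)

/-- The isometry `‖(∫ g dE - c) ψ‖ = ‖g - c‖` in `L²(⟨E ψ, ψ⟩)`. -/
theorem enorm_integral_sub_smul [Nonempty X] (E : PVM X H) {g : X → ℝ} (hg : Measurable g) (c : ℝ)
    (ψ : (E.integral hg).domain) :
    ‖E.integral hg ψ - (c : ℂ) • (ψ : H)‖ₑ = eLpNorm (fun x => g x - c) 2 (E.measure ψ) := by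
  set μ := E.measure (ψ : H)
  have h0 := E.tendsto_eLpNorm_approx hg ψ
  have h1 : Tendsto (fun n => eLpNorm (fun x => approx hg n x - c) 2 μ) atTop
      (𝓝 ‖E.integral hg ψ - (c : ℂ) • (ψ : H)‖ₑ) := by
    refine (((E.tendsto_simpleIntegral_approx hg ψ).sub_const ((c : ℂ) • (ψ : H))).enorm).congr
      fun n => ?_
    rw [← E.simpleIntegral_const c, ← E.simpleIntegral_sub, E.enorm_simpleIntegral]
    rfl
  have hm : ∀ n, AEStronglyMeasurable (⇑(approx hg n) - g) μ := fun n =>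
    ((approx hg n).measurable.sub hg).aestronglyMeasurable
  have hc : AEStronglyMeasurable (fun x => g x - c) μ := (hg.sub_const c).aestronglyMeasurable
  have hn : ∀ n, AEStronglyMeasurable (fun x => approx hg n x - c) μ := fun n =>
    ((approx hg n).measurable.sub_const c).aestronglyMeasurable
  apply le_antisymm
  · have h2 := h0.add (tendsto_const_nhds (x := eLpNorm (fun x => g x - c) 2 μ))
    rw [zero_add] at h2
    refine le_of_tendsto_of_tendsto' h1 h2 fun n => ?_
    have e : (fun x => approx hg n x - c) = (⇑(approx hg n) - g) + fun x => g x - c := by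
      ext x; simp
    rw [e]
    exact eLpNorm_add_le (hm n) hc (by norm_num)
  · refine ge_of_tendsto' (by simpa using h1.add h0) fun n => ?_
    have e : (fun x => g x - c) = (fun x => approx hg n x - c) - (⇑(approx hg n) - g) := by
      ext x; simp
    rw [e]
    exact eLpNorm_sub_le (hn n) (hm n) (by norm_num)

theorem apply_mem_integral_domain (E : PVM X H) {g : X → ℝ} (hg : Measurable g) {s : Set X}
    (hs : MeasurableSet s) {ψ : H} (hψ : ψ ∈ (E.integral hg).domain) :
    E.toPOVM s ψ ∈ (E.integral hg).domain := by
  change MemLp g 2 (E.measure (E.toPOVM s ψ))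
  rw [E.measure_apply_apply hs]
  exact MemLp.restrict s hψ

theorem integral_apply_apply (E : PVM X H) {g : X → ℝ} (hg : Measurable g) {s : Set X}
    (hs : MeasurableSet s) (ψ : (E.integral hg).domain) :
    E.integral hg ⟨E.toPOVM s ψ, E.apply_mem_integral_domain hg hs ψ.2⟩
      = E.toPOVM s (E.integral hg ψ) := by
  refine tendsto_nhds_unique (E.tendsto_simpleIntegral_approx hg _) ?_
  simp only [E.simpleIntegral_apply _ hs]
  exact ((E.toPOVM s).continuous.tendsto _).comp (E.tendsto_simpleIntegral_approx hg ψ)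

theorem apply_mem_integral_domain_of_bounded (E : PVM X H) {g : X → ℝ} (hg : Measurable g)
    {s : Set X} (hs : MeasurableSet s) {C : ℝ} (hC : ∀ x ∈ s, |g x| ≤ C) (ψ : H) :
    E.toPOVM s ψ ∈ (E.integral hg).domain := by
  change MemLp g 2 (E.measure (E.toPOVM s ψ))
  rw [E.measure_apply_apply hs]
  exact MemLp.of_bound hg.aestronglyMeasurable C (ae_restrict_of_forall_mem hs hC)

theorem norm_integral_sub_smul_le [Nonempty X] (E : PVM X H) {g : X → ℝ} (hg : Measurable g)
    {c r : ℝ} (hr : 0 ≤ r) (ψ : (E.integral hg).domain)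
    (h : ∀ᵐ x ∂E.measure (ψ : H), |g x - c| ≤ r) :
    ‖E.integral hg ψ - (c : ℂ) • (ψ : H)‖ ≤ r * ‖(ψ : H)‖ := by
  have h1 := eLpNorm_le_mul_eLpNorm_of_ae_le_mul (f := fun x => g x - c) (g := fun _ => (1 : ℝ))
    (c := r) (μ := E.measure (ψ : H)) (by simpa using h) 2
  rw [← E.enorm_integral_sub_smul hg, ← E.enorm_eq_eLpNorm_one, ← ofReal_norm, ← ofReal_norm,
    ← ENNReal.ofReal_mul hr] at h1
  exact (ENNReal.ofReal_le_ofReal_iff (by positivity)).1 h1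

theorem mul_norm_le_norm_integral_sub_smul [Nonempty X] (E : PVM X H) {g : X → ℝ}
    (hg : Measurable g) {c r : ℝ} (hr : 0 < r) (ψ : (E.integral hg).domain)
    (h : ∀ᵐ x ∂E.measure (ψ : H), r ≤ |g x - c|) :
    r * ‖(ψ : H)‖ ≤ ‖E.integral hg ψ - (c : ℂ) • (ψ : H)‖ := by
  have h1 := eLpNorm_le_mul_eLpNorm_of_ae_le_mul (f := fun _ => (1 : ℝ)) (g := fun x => g x - c)
    (c := r⁻¹) (μ := E.measure (ψ : H)) (by
      filter_upwards [h] with x hx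
      rw [norm_one, Real.norm_eq_abs, ← div_eq_inv_mul]
      exact (one_le_div hr).2 hx) 2
  rw [← E.enorm_integral_sub_smul hg, ← E.enorm_eq_eLpNorm_one, ← ofReal_norm, ← ofReal_norm,
    ← ENNReal.ofReal_mul (by positivity)] at h1
  have h2 := (ENNReal.ofReal_le_ofReal_iff (by positivity)).1 h1
  rwa [← div_eq_inv_mul, le_div_iff₀' hr] at h2

end PVM

/-! ### Uniqueness and support of the spectral measure -/

namespace LinearPMap.IsSpectralMeasure

variable {H : Type*} [NormedAddCommGroup H] [InnerProductSpace ℂ H] [CompleteSpace H]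
  {A : H →ₗ.[ℂ] H} {E E' : PVM ℝ H}

theorem apply_mem_domain (hE : A.IsSpectralMeasure E) {s : Set ℝ} (hs : MeasurableSet s) {ψ : H}
    (hψ : ψ ∈ A.domain) : E.toPOVM s ψ ∈ A.domain := by
  subst hE
  exact E.apply_mem_integral_domain measurable_id hs hψ

theorem apply_apply (hE : A.IsSpectralMeasure E) {s : Set ℝ} (hs : MeasurableSet s)
    (ψ : A.domain) : A ⟨E.toPOVM s ψ, hE.apply_mem_domain hs ψ.2⟩ = E.toPOVM s (A ψ) := by
  subst hE
  exact E.integral_apply_apply measurable_id hs ψ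

theorem apply_mem_domain_of_subset_closedBall (hE : A.IsSpectralMeasure E) {s : Set ℝ}
    (hs : MeasurableSet s) {c r : ℝ} (hsr : s ⊆ Metric.closedBall c r) (ψ : H) :
    E.toPOVM s ψ ∈ A.domain := by
  subst hE
  refine E.apply_mem_integral_domain_of_bounded measurable_id hs (C := r + |c|) (fun x hx => ?_) ψ
  have h : |x - c| ≤ r := by simpa [Real.dist_eq] using hsr hx
  have := abs_add_le (x - c) c
  rw [sub_add_cancel] at this
  exact this.trans (by gcongr)

theorem norm_sub_smul_le (hE : A.IsSpectralMeasure E) {s : Set ℝ} (hs : MeasurableSet s) {c r : ℝ}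
    (hr : 0 ≤ r) (hsr : ∀ x ∈ s, |x - c| ≤ r) {ψ : H} (h : E.toPOVM s ψ ∈ A.domain) :
    ‖A ⟨E.toPOVM s ψ, h⟩ - (c : ℂ) • E.toPOVM s ψ‖ ≤ r * ‖E.toPOVM s ψ‖ := by
  subst hE
  exact E.norm_integral_sub_smul_le measurable_id hr ⟨_, h⟩
    ((E.ae_measure_apply hs ψ).mono hsr)

theorem mul_norm_le_norm_sub_smul (hE : A.IsSpectralMeasure E) {s : Set ℝ} (hs : MeasurableSet s)
    {c r : ℝ} (hr : 0 < r) (hsr : ∀ x ∈ s, r ≤ |x - c|) {ψ : H} (h : E.toPOVM s ψ ∈ A.domain) :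
    r * ‖E.toPOVM s ψ‖ ≤ ‖A ⟨E.toPOVM s ψ, h⟩ - (c : ℂ) • E.toPOVM s ψ‖ := by
  subst hE
  exact E.mul_norm_le_norm_integral_sub_smul measurable_id hr ⟨_, h⟩
    ((E.ae_measure_apply hs ψ).mono hsr)

/-- The norm estimate behind uniqueness. The operator `Y = E'(t) E(s)` intertwines the two
restrictions of `A - c`, which has norm at most `r` on the range of `E(s)` and is bounded below by
`R > r` on the range of `E'(t)`. So `R ‖Y‖ ≤ r ‖Y‖`. -/
theorem mul_eq_zero (hE : A.IsSpectralMeasure E) (hE' : A.IsSpectralMeasure E') {s t : Set ℝ}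
    (hs : MeasurableSet s) (ht : MeasurableSet t) {c r R : ℝ} (hr : 0 ≤ r) (hrR : r < R)
    (hsr : ∀ x ∈ s, |x - c| ≤ r) (htR : ∀ x ∈ t, R ≤ |x - c|) :
    E'.toPOVM t * E.toPOVM s = 0 := by
  set Y := E'.toPOVM t * E.toPOVM s with hY
  have hR : 0 < R := hr.trans_lt hrR
  have key : ‖Y‖ ≤ r / R * ‖Y‖ := by
    refine Y.opNorm_le_bound (by positivity) fun ψ => ?_
    -- `φ` lies in the domain of `A`, where the projections commute with `A`, and `Y φ = Y ψ`.
    set φ := E.toPOVM s ψ with hφ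
    have hφd : φ ∈ A.domain := hE.apply_mem_domain_of_subset_closedBall hs
      (fun x hx => by simpa [Real.dist_eq] using hsr x hx) ψ
    have hφs : E.toPOVM s φ = φ := by rw [hφ, E.apply_apply hs hs, Set.inter_self]
    have h1 := hE'.mul_norm_le_norm_sub_smul ht hR htR (hE'.apply_mem_domain ht hφd)
    have h2 : A ⟨φ, hφd⟩ = E.toPOVM s (A ⟨φ, hφd⟩) := by
      rw [← hE.apply_apply hs ⟨φ, hφd⟩]
      simp only [hφs]
    have h3 : E'.toPOVM t (A ⟨φ, hφd⟩) - (c : ℂ) • E'.toPOVM t φ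
        = Y (A ⟨φ, hφd⟩ - (c : ℂ) • φ) := by
      rw [hY, mul_apply_eq_comp, _root_.map_sub, _root_.map_smul, ← h2, hφs, _root_.map_sub,
        _root_.map_smul]
    rw [hE'.apply_apply ht ⟨φ, hφd⟩, h3] at h1
    have h4 := hE.norm_sub_smul_le hs hr hsr hφd
    have h5 : ‖E.toPOVM s ψ‖ ≤ ‖ψ‖ := by
      rw [← sq_le_sq₀ (norm_nonneg _) (norm_nonneg _), E.norm_apply_sq hs]
      have h6 := E.norm_apply_sq MeasurableSet.univ ψ
      rw [E.univ', one_apply_eq_self] at h6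
      rw [h6]
      exact measureReal_mono (Set.subset_univ _)
    have h7 : R * ‖E'.toPOVM t φ‖ ≤ ‖Y‖ * (r * ‖ψ‖) :=
      h1.trans ((Y.le_opNorm _).trans (by gcongr; exact h4.trans (by gcongr)))
    change ‖E'.toPOVM t φ‖ ≤ _
    rw [div_mul_eq_mul_div, div_mul_eq_mul_div, le_div_iff₀' hR]
    linarith
  rw [div_mul_eq_mul_div, le_div_iff₀' hR] at key
  by_contra h
  have : 0 < ‖Y‖ := norm_pos_iff.2 h
  nlinarith

/-- The range of `E(I)` is contained in that of `E'(I)`, for a compact interval `I`: exhaust the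
complement of `I` by sets at a positive distance from `I` and use `mul_eq_zero`. -/
theorem apply_closedBall_apply_closedBall (hE : A.IsSpectralMeasure E)
    (hE' : A.IsSpectralMeasure E') (c : ℝ) {r : ℝ} (hr : 0 ≤ r) (ψ : H) :
    E'.toPOVM (Metric.closedBall c r) (E.toPOVM (Metric.closedBall c r) ψ)
      = E.toPOVM (Metric.closedBall c r) ψ := by
  have hm : MeasurableSet (Metric.closedBall c r) := Metric.isClosed_closedBall.measurableSet
  set φ := E.toPOVM (Metric.closedBall c r) ψ with hφ
  have h : E'.toPOVM (Metric.closedBall c r)ᶜ φ = 0 := by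
    rw [E'.apply_eq_zero_iff hm.compl]
    have hU : (Metric.closedBall c r)ᶜ
        ⊆ ⋃ n : ℕ, {x | r + 1 / (n + 1 : ℝ) ≤ |x - c|} := by
      intro x hx
      rw [Set.mem_compl_iff, Metric.mem_closedBall, not_le, Real.dist_eq] at hx
      obtain ⟨n, hn⟩ := exists_nat_one_div_lt (sub_pos.2 hx)
      exact Set.mem_iUnion.2 ⟨n, by simp only [Set.mem_ofPred_eq]; linarith⟩
    refine measure_mono_null hU (measure_iUnion_null fun n => ?_)
    have ht : MeasurableSet {x : ℝ | r + 1 / (n + 1 : ℝ) ≤ |x - c|} :=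
      measurableSet_le measurable_const (by fun_prop)
    rw [← E'.apply_eq_zero_iff ht]
    have h0 := hE.mul_eq_zero hE' hm ht (c := c) hr
      (lt_add_of_pos_right r (by positivity : (0 : ℝ) < 1 / (n + 1 : ℝ)))
      (fun x hx => by simpa [Real.dist_eq] using hx) (fun x hx => hx)
    exact congrArg (fun T : H →L[ℂ] H => T ψ) h0
  rw [E'.apply_compl hm, sub_eq_zero] at h
  exact h.symm

/-- A self-adjoint operator has at most one spectral measure, up to the values on sets that are not
measurable. -/
theorem measure_eq (hE : A.IsSpectralMeasure E) (hE' : A.IsSpectralMeasure E') (ψ : H) :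
    E.measure ψ = E'.measure ψ := by
  refine Measure.ext_of_Icc _ _ fun a b hab => ?_
  obtain ⟨c, r, hr, hcr⟩ : ∃ c r : ℝ, 0 ≤ r ∧ Set.Icc a b = Metric.closedBall c r :=
    ⟨(a + b) / 2, (b - a) / 2, by linarith, Real.Icc_eq_closedBall a b⟩
  rw [hcr]
  have hm : MeasurableSet (Metric.closedBall c r) := Metric.isClosed_closedBall.measurableSet
  rw [E.toPOVM.measure_apply ψ hm, E'.toPOVM.measure_apply ψ hm]
  congr 2
  -- `E'(I) E(I) = E(I)`, and the adjoint of `E(I) E'(I) = E'(I)` is `E'(I) E(I) = E'(I)`.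
  have h1 := hE.apply_closedBall_apply_closedBall hE' c hr ψ
  suffices h : E.toPOVM (Metric.closedBall c r) ψ = E'.toPOVM (Metric.closedBall c r) ψ by rw [h]
  refine ext_inner_left ℂ fun χ => ?_
  have h2 := hE'.apply_closedBall_apply_closedBall hE c hr χ
  have hs := (E.isPositive' _ hm).isSymmetric
  have hs' := (E'.isPositive' _ hm).isSymmetric
  calc inner ℂ χ (E.toPOVM (Metric.closedBall c r) ψ)
      = inner ℂ χ (E'.toPOVM (Metric.closedBall c r) (E.toPOVM (Metric.closedBall c r) ψ)) := by
        rw [h1]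
    _ = inner ℂ (E.toPOVM (Metric.closedBall c r) (E'.toPOVM (Metric.closedBall c r) χ)) ψ := by
        rw [show inner ℂ χ (E'.toPOVM _ (E.toPOVM (Metric.closedBall c r) ψ)) = _ from (hs' _ _).symm]
        exact (hs _ _).symm
    _ = inner ℂ χ (E'.toPOVM (Metric.closedBall c r) ψ) := by
        rw [h2]
        exact hs' _ _

/-- The spectral measure is concentrated on the spectrum. If `t` is not in the spectrum, then
`‖ψ‖ ≤ C ‖(A - t) ψ‖` for some `C`, and so no nonzero vector lies in the range of `E` of an interval
of radius less than `C⁻¹` about `t`. -/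
theorem measure_compl_realSpectrum (hE : A.IsSpectralMeasure E) (hA : IsSelfAdjoint A) (ψ : H) :
    E.measure ψ A.realSpectrumᶜ = 0 := by
  refine measure_null_of_locally_null _ fun t ht => ?_
  simp only [realSpectrum, Set.mem_compl_iff, Set.mem_ofPred_eq, not_not] at ht
  let B : A.domain →ₗ[ℂ] H := A.toFun - (t : ℂ) • A.domain.subtype
  have hB : Function.Bijective B := ht
  let e : A.domain ≃ₗ[ℂ] H := LinearEquiv.ofBijective B hB
  let R : H →ₗ[ℂ] H := A.domain.subtype ∘ₗ e.symm.toLinearMap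
  have hAs : A.IsFormalAdjoint A := by
    have h := A.adjoint_isFormalAdjoint hA.dense_domain
    rwa [isSelfAdjoint_def.1 hA] at h
  have hBs : ∀ x y : A.domain, inner ℂ (B x) (y : H) = inner ℂ (x : H) (B y) := fun x y => by
    simp only [B, LinearMap.sub_apply, LinearMap.smul_apply, inner_sub_left, inner_sub_right,
      inner_smul_left, inner_smul_right, Complex.conj_ofReal, Submodule.subtype_apply]
    rw [show inner ℂ (A.toFun x) (y : H) = _ from hAs x y]
    rfl
  have hR : R.IsSymmetric := fun χ φ => by
    have h := hBs (e.symm χ) (e.symm φ)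
    rw [show B (e.symm χ) = χ from e.apply_symm_apply χ,
      show B (e.symm φ) = φ from e.apply_symm_apply φ] at h
    exact h.symm
  -- The inverse of `A - t` is symmetric and everywhere defined, hence bounded.
  let R' : H →L[ℂ] H := ⟨R, hR.continuous⟩
  have hr : (0 : ℝ) < (‖R'‖ + 1)⁻¹ := by positivity
  set s := Metric.closedBall t (‖R'‖ + 1)⁻¹ with hs
  have hm : MeasurableSet s := Metric.isClosed_closedBall.measurableSet
  refine ⟨s, mem_nhdsWithin_of_mem_nhds (Metric.closedBall_mem_nhds _ hr), ?_⟩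
  rw [← E.apply_eq_zero_iff hm]
  have hd := hE.apply_mem_domain_of_subset_closedBall hm subset_rfl ψ
  have h1 := hE.norm_sub_smul_le hm hr.le
    (fun x hx => by simpa [hs, Real.dist_eq] using hx) hd
  have h2 : E.toPOVM s ψ = R' (A ⟨E.toPOVM s ψ, hd⟩ - (t : ℂ) • E.toPOVM s ψ) :=
    (congrArg Subtype.val (e.symm_apply_apply ⟨E.toPOVM s ψ, hd⟩)).symm
  have h3 := (congrArg norm h2).le.trans (R'.le_opNorm _)
  by_contra h
  have h4 : 0 < ‖E.toPOVM s ψ‖ := norm_pos_iff.2 h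
  have h5 : ‖E.toPOVM s ψ‖ ≤ ‖R'‖ * ((‖R'‖ + 1)⁻¹ * ‖E.toPOVM s ψ‖) :=
    h3.trans (by gcongr)
  rw [← mul_assoc, le_mul_iff_one_le_left h4, ← div_eq_mul_inv, one_le_div (by positivity)] at h5
  linarith

end LinearPMap.IsSpectralMeasure

/-! ### Images of projection valued measures -/

namespace PVM

variable {X Y H : Type*} [MeasurableSpace X] [MeasurableSpace Y] [NormedAddCommGroup H]
  [InnerProductSpace ℂ H]

/-- The image `Δ ↦ E(g⁻¹ Δ)` of a projection valued measure under a measurable map `g`. -/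
def map (E : PVM X H) {g : X → Y} (hg : Measurable g) : PVM Y H where
  toFun s := E.toPOVM (g ⁻¹' s)
  isPositive' s hs := E.isPositive' _ (hg hs)
  hasSum' Δ hΔ hd ψ φ := by
    rw [Set.preimage_iUnion]
    exact E.hasSum' _ (fun n => hg (hΔ n)) (fun i j hij => (hd hij).preimage g) ψ φ
  univ' := E.univ'
  orthogonal' s t hs ht h := E.orthogonal' _ _ (hg hs) (hg ht) (h.preimage g)

theorem measure_map (E : PVM X H) {g : X → Y} (hg : Measurable g) (ψ : H) :
    (E.map hg).measure ψ = (E.measure ψ).map g := by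
  ext s hs
  rw [Measure.map_apply hg hs, POVM.measure_apply _ _ hs, E.toPOVM.measure_apply _ (hg hs)]
  rfl

theorem simpleIntegral_map (E : PVM X H) {g : X → Y} (hg : Measurable g) (s : SimpleFunc Y ℝ) :
    (E.map hg).simpleIntegral s = E.simpleIntegral (s.comp g hg) := by
  refine (Finset.sum_subset (s.range_comp_subset_range hg) fun y _ hy => ?_).symm
  have h : ⇑(s.comp g hg) ⁻¹' {y} = ∅ := by
    rw [SimpleFunc.mem_range] at hy
    exact Set.preimage_singleton_eq_empty.2 hy
  change (y : ℂ) • E.toPOVM (⇑(s.comp g hg) ⁻¹' {y}) = 0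
  rw [h, E.toPOVM.empty, smul_zero]

/-- Change of variables: `∫ λ d(g_* E) = ∫ g dE`. -/
theorem isSpectralMeasure_map [CompleteSpace H] (E : PVM X H) {g : X → ℝ} (hg : Measurable g) :
    (E.integral hg).IsSpectralMeasure (E.map hg) := by
  have hdom : ((E.map hg).integral measurable_id).domain = (E.integral hg).domain := by
    ext ψ
    change MemLp id 2 ((E.map hg).measure ψ) ↔ MemLp g 2 (E.measure ψ)
    rw [E.measure_map hg, memLp_map_measure_iff aestronglyMeasurable_id hg.aemeasurable,
      Function.id_comp]
  refine LinearPMap.ext hdom fun ψ h h' => ?_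
  have h1 := (E.map hg).tendsto_simpleIntegral_approx measurable_id ⟨ψ, h⟩
  refine tendsto_nhds_unique h1 ?_
  simp only [E.simpleIntegral_map hg]
  refine E.tendsto_simpleIntegral hg ⟨ψ, h'⟩ ?_
  refine ((E.map hg).tendsto_eLpNorm_approx measurable_id ⟨ψ, h⟩).congr fun n => ?_
  rw [E.measure_map hg, eLpNorm_map_measure
    ((approx measurable_id n).measurable.sub measurable_id).aestronglyMeasurable hg.aemeasurable]
  rfl

end PVM

/-! ### Smearings of functions of an operator -/

/-- A measurable function `f` on a measurable set that is injective off a null set has a measurable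
almost everywhere left inverse. -/
theorem POVM.AEOneToOne.exists_measurable_leftInverse {H : Type*} [NormedAddCommGroup H]
    [InnerProductSpace ℂ H] {F : POVM ℝ H} {S : Set ℝ} {f : S → ℝ} (h : F.AEOneToOne f)
    (hS : MeasurableSet S) (hf : Measurable f) :
    ∃ k : ℝ → ℝ, Measurable k ∧ ∀ ψ : H, F.measure ψ Sᶜ = 0 →
      ∀ᵐ t ∂F.measure ψ, k (Function.extend Subtype.val f 0 t) = t := by
  obtain ⟨N, hNS, hN, hF, hinj⟩ := h
  have := hN.standardBorel
  let j : N → ℝ := fun t => f ⟨t, hNS t.2⟩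
  -- By the Lusin–Souslin theorem, an injective Borel map is a measurable embedding.
  have hj : MeasurableEmbedding j := by
    refine Measurable.measurableEmbedding (hf.comp (by fun_prop)) fun a b hab => ?_
    have hab' := hinj (x₁ := ⟨a, hNS a.2⟩) (x₂ := ⟨b, hNS b.2⟩) a.2 b.2 hab
    exact Subtype.ext (congrArg (fun x : S => (x : ℝ)) hab')
  obtain ⟨k, hk, hkj⟩ := hj.exists_measurable_extend (g := Subtype.val) measurable_subtype_coe
    fun _ => ⟨0⟩
  refine ⟨k, hk, fun ψ hψ => ?_⟩
  have h1 : F.measure ψ (S \ N) = 0 := by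
    rw [F.measure_apply ψ (hS.diff hN), hF]
    simp
  refine measure_mono_null (t := (S \ N) ∪ Sᶜ) (fun t ht => ?_) (measure_union_null h1 hψ)
  by_contra hc
  have hc' : t ∈ S ∧ t ∈ N := by
    simp only [Set.mem_union, Set.mem_sdiff, Set.mem_compl_iff] at hc
    tauto
  refine ht ?_
  have h2 : Function.extend Subtype.val f 0 t = j ⟨t, hc'.2⟩ :=
    Subtype.val_injective.extend_apply f 0 ⟨t, hc'.1⟩
  change k _ = t
  rw [h2]
  exact congrFun hkj ⟨t, hc'.2⟩

/-- A smearing of `A` is a smearing of `f(A)` for every almost everywhere one-to-one `f`. -/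
theorem POVM.IsSmearing.borelFun {H X : Type*} [NormedAddCommGroup H] [InnerProductSpace ℂ H]
    [CompleteSpace H] [MeasurableSpace X] {A : H →ₗ.[ℂ] H} {F : POVM X H} (hF : F.IsSmearing A)
    (hA : IsSelfAdjoint A) {f : A.realSpectrum → ℝ} (hf : Measurable f)
    (hinj : A.spectralMeasure.AEOneToOne f) : F.IsSmearing (A.borelFun hA f hf) := by
  obtain ⟨E', hE', κ, hκ, hFκ⟩ := hF
  have hE : A.IsSpectralMeasure A.spectralMeasure := by
    rw [LinearPMap.spectralMeasure, dif_pos ⟨E', hE'⟩]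
    exact Exists.choose_spec _
  obtain ⟨k, hk, hkf⟩ := hinj.exists_measurable_leftInverse
    (LinearPMap.isClosed_realSpectrum hA).measurableSet hf
  have hg := LinearPMap.measurable_extend hA hf
  refine ⟨A.spectralMeasure.map hg, A.spectralMeasure.isSpectralMeasure_map hg, κ.comap k hk,
    inferInstance, fun Δ hΔ ψ => ?_⟩
  have hm : Measurable fun t => (κ t).real Δ := (κ.measurable_coe hΔ).ennreal_toReal
  rw [hFκ Δ hΔ ψ, ← hE.measure_eq hE' ψ, PVM.measure_map _ hg]
  congr 1
  refine Eq.trans ?_ (integral_map hg.aemeasurable (hm.comp hk).aestronglyMeasurable).symm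
  refine integral_congr_ae ?_
  filter_upwards [hkf ψ (hE.measure_compl_realSpectrum hA ψ)] with t ht
  rw [Function.comp_apply, ht]

theorem mainTheorem9 {H X₁ X₂ : Type*}
    [NormedAddCommGroup H] [InnerProductSpace ℂ H] [CompleteSpace H]
    [TopologicalSpace X₁] [T2Space X₁] [LocallyCompactSpace X₁] [SecondCountableTopology X₁]
    [MeasurableSpace X₁] [BorelSpace X₁]
    [TopologicalSpace X₂] [T2Space X₂] [LocallyCompactSpace X₂] [SecondCountableTopology X₂]
    [MeasurableSpace X₂] [BorelSpace X₂]
    (A₁ A₂ : H →ₗ.[ℂ] H) (hA₁ : IsSelfAdjoint A₁) (hA₂ : IsSelfAdjoint A₂)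
    (F₁ : POVM X₁ H) (F₂ : POVM X₂ H) (hF : F₁.Compatible F₂)
    (hF₁ : F₁.IsSmearing A₁) (hF₂ : F₂.IsSmearing A₂)
    (f₁ : A₁.realSpectrum → ℝ) (hf₁ : Measurable f₁)
    (f₂ : A₂.realSpectrum → ℝ) (hf₂ : Measurable f₂)
    (hinj₁ : A₁.spectralMeasure.AEOneToOne f₁) (hinj₂ : A₂.spectralMeasure.AEOneToOne f₂) :
    F₁.Compatible F₂ ∧
      F₁.IsSmearing (A₁.borelFun hA₁ f₁ hf₁) ∧ F₂.IsSmearing (A₂.borelFun hA₂ f₂ hf₂) := by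
  exact ⟨hF, hF₁.borelFun hA₁ hf₁ hinj₁, hF₂.borelFun hA₂ hf₂ hinj₂⟩
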